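/- Let $\mathbb D=\{z\in\mathbb C:|z|<1\}$, and let $\mathcal B$ be the set of all analytic functions $h$ in $\mathbb D$ with $|h(z)|\le 1$ for all $z\in\mathbb D$. For $x\in[0,1]$ put $$r_1(x)=\begin{cases}\sqrt{\dfrac{1-x}{2}} & \text{if } 0\le x<\tfrac12,\\[2mm] \dfrac{1}{1+2x} & \text{if } \tfrac12\le x\le 1.\end{cases}$$ Let $f(z)=\sum_{k=0}^\infty a_kz^k$ and $g(z)=\sum_{k=0}^\infty b_kz^k$ be analytic in $\mathbb D$. Suppose that there are $\Phi\in\mathcal B$ and $\omega\in\mathcal B$ with $\omega(0)=0$ such that $f(z)=\Phi(z)\,g(\omega(z))$ for all $z\in\mathbb D$ (that is, $f$ is quasi-subordinate to $g$). Then $$\sum_{k=0}^\infty |a_k|r^k\le\sum_{k=0}^\infty |b_k|r^k<\infty\qquad\text{for all } 0\le r\le\min\{r_1(|\Phi(0)|),\,r_1(|\omega'(0)|)\}.$$ Moreover $\min\{r_1(|\Phi(0)|),\,r_1(|\omega'(0)|)\}\ge \tfrac13$, so this refines the earlier radius $1/3$. -/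

import Mathlib

/-- The open unit disk `𝔻` in the complex plane. -/
def unitDisk : Set ℂ := Metric.ball (0 : ℂ) 1

/-- The class `𝓑` of all analytic functions `f` in the unit disk with `|f z| ≤ 1` there. -/
def classB : Set (ℂ → ℂ) :=
  {f | AnalyticOnNhd ℂ f unitDisk ∧ ∀ z ∈ unitDisk, ‖f z‖ ≤ 1}

/-- The radius function `r₁`, meant for `x ∈ [0,1]`: it is `√((1 - x) / 2)` on `[0, 1/2)` and
`1 / (1 + 2 x)` on `[1/2, 1]`. -/
noncomputable def bohrR1 (x : ℝ) : ℝ :=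
  if x < 1 / 2 then Real.sqrt ((1 - x) / 2) else 1 / (1 + 2 * x)

/-! Write $f=\sum_n b_n\,\Phi\,\omega^n$. Majorant sums are submultiplicative, so if at $r$ that of
$\Phi$ is at most $1$ and that of $\omega$ at most $r$, then that of $\Phi\omega^n$ is at most
$r^n$; the triangle inequality and an exchange of summations finish (`tsum_norm_superposition_le`).
Since $\omega(z)/z\in\mathcal B$ has value $\omega'(0)$ at $0$, both bounds follow from the refined
Bohr inequality `tsum_norm_mul_pow_le_one`.

For that inequality let $h=\sum a_kz^k\in\mathcal B$ and $x=|a_0|<1$. Schwarz–Pick and Parseval on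
$|z|^2=\rho$ give $(1-x^2\rho)\sum_{k\ge1}|a_k|^2\rho^k\le\rho(1-x^2)^2$. Cauchy–Schwarz then bounds
$\sum_{k\ge1}|a_k|r^k$, and the best $\rho\le1$ yields the two branches of $r_1$. -/

open Filter Topology MeasureTheory ComplexConjugate

/-! ### Parseval on the unit circle -/

section Parseval

open AddCircle

/-- The squared `ℓ²` norm of a summable sequence is the squared `L²` norm of its Fourier series. -/
lemma hasSum_norm_sq_fourierSeries {c : ℕ → ℂ} (hc : Summable fun k => ‖c k‖) :
    ∃ F : C(AddCircle (1 : ℝ), ℂ),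
      (∀ x, HasSum (fun k => c k * (fourier 1 x : ℂ) ^ k) (F x)) ∧
      HasSum (fun k => ‖c k‖ ^ 2) (‖ContinuousMap.toLp 2 haarAddCircle ℂ F‖ ^ 2) := by
  have hs : Summable fun k : ℕ => c k • (fourier (k : ℤ) : C(AddCircle (1 : ℝ), ℂ)) := by
    refine Summable.of_norm ?_
    simpa [norm_smul, fourier_norm] using hc
  refine ⟨∑' k : ℕ, c k • (fourier (k : ℤ) : C(AddCircle (1 : ℝ), ℂ)), fun x => ?_, ?_⟩
  · have h := ContinuousMap.hasSum_apply hs.hasSum x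
    convert h using 2 with k
    simp [fourier_apply, toCircle_nsmul]
  · have h := (ContinuousMap.toLp (E := ℂ) 2 haarAddCircle ℂ).hasSum hs.hasSum
    have h2 := h.norm.pow 2
    -- By orthonormality, the squared norm of each finite partial sum is exactly the corresponding
    -- sum of $|c_k|^2$.
    refine Tendsto.congr (fun s => ?_) h2
    have ho : Orthonormal ℂ fun k : ℕ => @fourierLp 1 _ 2 _ (k : ℤ) :=
      orthonormal_fourier.comp _ Nat.cast_injective
    have hi := ho.inner_sum c c s
    rw [inner_self_eq_norm_sq_to_K] at hi
    have : ((‖∑ k ∈ s, c k • @fourierLp 1 _ 2 _ (k : ℤ)‖ ^ 2 : ℝ) : ℂ)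
        = ((∑ k ∈ s, ‖c k‖ ^ 2 : ℝ) : ℂ) := by
      push_cast
      refine hi.trans (Finset.sum_congr rfl fun k _ => ?_)
      rw [Complex.conj_mul']
    simpa [fourierLp] using Complex.ofReal_injective this

/-- A pointwise inequality between power series on the unit circle gives an inequality between the
`ℓ²` norms of their coefficients. -/
lemma tsum_norm_sq_le_of_norm_le {c d : ℕ → ℂ} (hc : Summable fun k => ‖c k‖)
    (hd : Summable fun k => ‖d k‖)
    (h : ∀ u : ℂ, ‖u‖ = 1 → ‖∑' k, c k * u ^ k‖ ≤ ‖∑' k, d k * u ^ k‖) :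
    Summable (fun k => ‖c k‖ ^ 2) ∧ Summable (fun k => ‖d k‖ ^ 2) ∧
      ∑' k, ‖c k‖ ^ 2 ≤ ∑' k, ‖d k‖ ^ 2 := by
  obtain ⟨F, hF, hF2⟩ := hasSum_norm_sq_fourierSeries hc
  obtain ⟨G, hG, hG2⟩ := hasSum_norm_sq_fourierSeries hd
  refine ⟨hF2.summable, hG2.summable, ?_⟩
  rw [hF2.tsum_eq, hG2.tsum_eq]
  gcongr
  refine Lp.norm_le_norm_of_ae_le ?_
  filter_upwards [ContinuousMap.coeFn_toLp (p := 2) (𝕜 := ℂ) haarAddCircle F,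
    ContinuousMap.coeFn_toLp (p := 2) (𝕜 := ℂ) haarAddCircle G] with x hx hy
  rw [hx, hy, ← (hF x).tsum_eq, ← (hG x).tsum_eq]
  exact h _ (by rw [fourier_apply]; exact Circle.norm_coe _)

end Parseval

/-! ### Schwarz–Pick and the refined Bohr inequality -/

lemma mem_unitDisk {z : ℂ} : z ∈ unitDisk ↔ ‖z‖ < 1 := mem_ball_zero_iff

/-- The **Schwarz–Pick** inequality at the origin. -/
lemma norm_sub_le_of_mem_classB {h : ℂ → ℂ} (hh : h ∈ classB) (h0 : ‖h 0‖ < 1) {z : ℂ}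
    (hz : ‖z‖ < 1) : ‖h z - h 0‖ ≤ ‖z‖ * ‖1 - conj (h 0) * h z‖ := by
  obtain ⟨ha, hb⟩ := hh
  have hden : ∀ w ∈ unitDisk, 1 - conj (h 0) * h w ≠ 0 := fun w hw he => by
    have h1 : ‖conj (h 0) * h w‖ = 1 := by rw [← sub_eq_zero.1 he]; simp
    rw [norm_mul, RCLike.norm_conj] at h1
    nlinarith [hb w hw, norm_nonneg (h 0), norm_nonneg (h w)]
  have hd : DifferentiableOn ℂ h (Metric.ball 0 1) := ha.differentiableOn
  have key := Complex.norm_le_norm_of_mapsTo_ball (R := 1)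
    (f := fun w => (h w - h 0) / (1 - conj (h 0) * h w)) (z := z)
    ((hd.sub_const _).div ((hd.const_mul _).const_sub _) hden) ?_ (by simp) hz
  · rwa [norm_div, div_le_iff₀ (norm_pos_iff.2 (hden z (mem_unitDisk.2 hz)))] at key
  · intro w hw
    rw [mem_closedBall_zero_iff, norm_div, div_le_one (norm_pos_iff.2 (hden w hw))]
    refine (abs_le_of_sq_le_sq' ?_ (norm_nonneg _)).2
    have hw1 := hb w hw
    have e : ‖1 - conj (h 0) * h w‖ ^ 2 - ‖h w - h 0‖ ^ 2
        = (1 - ‖h 0‖ ^ 2) * (1 - ‖h w‖ ^ 2) := by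
      simp only [← Complex.normSq_eq_norm_sq, Complex.normSq_apply]
      simp
      ring
    have : 0 ≤ (1 - ‖h 0‖ ^ 2) * (1 - ‖h w‖ ^ 2) :=
      mul_nonneg (by nlinarith [norm_nonneg (h 0)]) (by nlinarith [norm_nonneg (h w)])
    linarith

lemma summable_norm_mul_pow_of_hasSum {h : ℂ → ℂ} {a : ℕ → ℂ}
    (ha : ∀ z ∈ unitDisk, HasSum (fun k => a k * z ^ k) (h z)) {r : ℝ} (hr0 : 0 ≤ r)
    (hr1 : r < 1) : Summable fun k => ‖a k‖ * r ^ k := by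
  have hr : ‖(r : ℂ)‖ = r := by simp [abs_of_nonneg hr0]
  simpa [hr, abs_of_nonneg hr0] using (ha r (mem_unitDisk.2 (by rwa [hr]))).summable.norm

lemma apply_zero_of_hasSum {h : ℂ → ℂ} {a : ℕ → ℂ}
    (ha : ∀ z ∈ unitDisk, HasSum (fun k => a k * z ^ k) (h z)) : h 0 = a 0 := by
  refine (ha 0 (by simp [unitDisk])).unique ?_
  convert hasSum_single (f := fun k => a k * (0 : ℂ) ^ k) 0 ?_ using 1
  · simp
  · intro k hk; simp [hk]

/-- The weighted `ℓ²` bound for the Taylor coefficients of a function in `𝓑`. -/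
lemma tsum_norm_sq_mul_pow_le {h : ℂ → ℂ} (hh : h ∈ classB) {a : ℕ → ℂ}
    (ha : ∀ z ∈ unitDisk, HasSum (fun k => a k * z ^ k) (h z)) {s : ℝ} (hs0 : 0 ≤ s)
    (hs1 : s < 1) :
    Summable (fun k => ‖a (k + 1)‖ ^ 2 * (s ^ 2) ^ (k + 1)) ∧
    (1 - ‖a 0‖ ^ 2 * s ^ 2) * ∑' k, ‖a (k + 1)‖ ^ 2 * (s ^ 2) ^ (k + 1)
      ≤ s ^ 2 * (1 - ‖a 0‖ ^ 2) ^ 2 := by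
  have h0 := apply_zero_of_hasSum ha
  have hsum := summable_norm_mul_pow_of_hasSum ha hs0 hs1
  have hns : ‖(s : ℂ)‖ = s := by simp [abs_of_nonneg hs0]
  have hmem : ∀ u : ℂ, ‖u‖ = 1 → (s : ℂ) * u ∈ unitDisk := fun u hu =>
    mem_unitDisk.2 (by rwa [norm_mul, hns, hu, mul_one])
  have hu1 : ∀ u : ℂ, ‖u‖ = 1 → HasSum (fun k => a k * (s : ℂ) ^ k * u ^ k) (h (s * u)) :=
    fun u hu => by simpa [mul_pow, mul_assoc] using ha _ (hmem u hu)
  have hca : Summable fun k => ‖a k * (s : ℂ) ^ k‖ := by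
    simpa [abs_of_nonneg hs0] using hsum
  have hsq : ∀ k, ‖a k * (s : ℂ) ^ k‖ ^ 2 = ‖a k‖ ^ 2 * (s ^ 2) ^ k := fun k => by
    rw [norm_mul, norm_pow, hns, mul_pow]; ring
  have hx1 : ‖a 0‖ ≤ 1 := h0 ▸ hh.2 0 (by simp [unitDisk])
  have hone : Summable (fun k : ℕ => ‖(if k = 0 then 1 else 0 : ℂ)‖) :=
    summable_of_ne_finset_zero (s := {0}) (by simp +contextual)
  obtain ⟨S1, -, hle⟩ := tsum_norm_sq_le_of_norm_le hca hone (fun u hu => by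
    rw [(hu1 u hu).tsum_eq, tsum_eq_single 0 (by simp +contextual)]
    simpa using hh.2 _ (hmem u hu))
  rw [tsum_eq_single (f := fun k : ℕ => ‖(if k = 0 then 1 else 0 : ℂ)‖ ^ 2) 0
    (by simp +contextual)] at hle
  simp only [hsq] at S1 hle
  have S2 := (summable_nat_add_iff 1).2 S1
  refine ⟨S2, ?_⟩
  rw [S1.tsum_eq_zero_add] at hle
  -- If $|a_0|=1$, Schwarz–Pick is unavailable, but comparison with the constant $1$ already kills
  -- the tail.
  rcases hx1.eq_or_lt with hx | hx
  · simp only [hx] at hle ⊢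
    have : (∑' k, ‖a (k + 1)‖ ^ 2 * (s ^ 2) ^ (k + 1)) ≤ 0 := by
      simp at hle ⊢; linarith
    have h2 : 0 ≤ 1 - s ^ 2 := by nlinarith
    nlinarith
  -- In powers of $u$, these are the coefficients of $h(su)-a_0$ and $s(1-\overline{a_0}h(su))$, the
  -- two sides of Schwarz–Pick.
  · set c : ℕ → ℂ := fun k => if k = 0 then 0 else a k * (s : ℂ) ^ k with hc
    set d : ℕ → ℂ := fun k => s * (if k = 0 then 1 - conj (a 0) * a 0
      else - conj (a 0) * (a k * (s : ℂ) ^ k)) with hd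
    have hcs : Summable fun k => ‖c k‖ :=
      (summable_nat_add_iff 1).1 (by simpa [hc] using (summable_nat_add_iff 1).2 hca)
    have hds : Summable fun k => ‖d k‖ := by
      refine (summable_nat_add_iff 1).1 ?_
      simpa [hd, mul_assoc] using
        (((summable_nat_add_iff 1).2 hca).mul_left ‖conj (a 0)‖).mul_left ‖(s : ℂ)‖
    have hle2 := tsum_norm_sq_le_of_norm_le hcs hds (fun u hu => by
      have e0 := hu1 u hu
      have ec : HasSum (fun k => c k * u ^ k) (h (s * u) - a 0) := by
        refine (e0.sub (hasSum_ite_eq 0 (a 0))).congr_fun fun k => ?_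
        rcases k with _ | k <;> simp [hc]
      have ed : HasSum (fun k => d k * u ^ k) (s * (1 - conj (a 0) * h (s * u))) := by
        refine (((hasSum_ite_eq 0 1).sub (e0.mul_left (conj (a 0)))).mul_left (s : ℂ)).congr_fun
          fun k => ?_
        rcases k with _ | k <;> simp [hd]
        ring
      rw [ec.tsum_eq, ed.tsum_eq]
      have := norm_sub_le_of_mem_classB hh (by rwa [h0]) (mem_unitDisk.1 (hmem u hu))
      simpa [h0, hu] using this)
    obtain ⟨T1, T2, hle2⟩ := hle2
    rw [T1.tsum_eq_zero_add, T2.tsum_eq_zero_add] at hle2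
    have ec : ∀ k, ‖c (k + 1)‖ ^ 2 = ‖a (k + 1)‖ ^ 2 * (s ^ 2) ^ (k + 1) := fun k => by
      simp only [hc, Nat.succ_ne_zero, if_false, hsq]
    have ed : ∀ k, ‖d (k + 1)‖ ^ 2
        = s ^ 2 * ‖a 0‖ ^ 2 * (‖a (k + 1)‖ ^ 2 * (s ^ 2) ^ (k + 1)) := fun k => by
      simp only [hd, Nat.succ_ne_zero, if_false]
      rw [norm_mul, norm_mul, norm_neg, RCLike.norm_conj, hns, mul_pow, mul_pow, hsq]
      ring
    have hd0 : ‖d 0‖ ^ 2 = s ^ 2 * (1 - ‖a 0‖ ^ 2) ^ 2 := by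
      have : d 0 = ((s * (1 - ‖a 0‖ ^ 2) : ℝ) : ℂ) := by
        simp [hd, Complex.conj_mul']
      rw [this, Complex.norm_real, Real.norm_eq_abs, sq_abs, mul_pow]
    have hc0 : ‖c 0‖ ^ 2 = 0 := by simp [hc]
    simp only [ec, ed, hd0, hc0, tsum_mul_left] at hle2
    linarith

/-- Bohr-type estimate for finite sections of the Taylor series, with a free weight `ρ`. -/
lemma sq_sum_mul_le_of_lt_one {h : ℂ → ℂ} (hh : h ∈ classB) {a : ℕ → ℂ}
    (ha : ∀ z ∈ unitDisk, HasSum (fun k => a k * z ^ k) (h z)) {r ρ : ℝ}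
    (hρ : r ^ 2 < ρ) (hρ1 : ρ < 1) (n : ℕ) :
    (∑ k ∈ Finset.range n, ‖a (k + 1)‖ * r ^ (k + 1)) ^ 2 *
      ((1 - ‖a 0‖ ^ 2 * ρ) * (ρ - r ^ 2)) ≤ ρ * (1 - ‖a 0‖ ^ 2) ^ 2 * r ^ 2 := by
  have hρ0 : 0 < ρ := (sq_nonneg r).trans_lt hρ
  set s := Real.sqrt ρ with hs
  have hs0 : 0 < s := Real.sqrt_pos.2 hρ0
  have hss : s ^ 2 = ρ := Real.sq_sqrt hρ0.le
  have hs1 : s < 1 := by nlinarith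
  have hx1 : ‖a 0‖ ≤ 1 := apply_zero_of_hasSum ha ▸ hh.2 0 (by simp [unitDisk])
  obtain ⟨S, hS⟩ := tsum_norm_sq_mul_pow_le hh ha hs0.le hs1
  have hfin := S.sum_le_tsum (Finset.range n) (fun k _ => by positivity)
  set q := r ^ 2 / ρ with hq
  have hq0 : 0 ≤ q := by positivity
  have hq1 : q < 1 := (div_lt_one hρ0).2 hρ
  have hgs : Summable fun k => q ^ (k + 1) :=
    (summable_nat_add_iff 1).2 (summable_geometric_of_lt_one hq0 hq1)
  have hgeo : ∑ k ∈ Finset.range n, q ^ (k + 1) ≤ q / (1 - q) := by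
    refine (hgs.sum_le_tsum _ fun k _ => by positivity).trans_eq ?_
    simp only [pow_succ', tsum_mul_left, tsum_geometric_of_lt_one hq0 hq1, div_eq_mul_inv]
  -- Cauchy–Schwarz for the splitting $|a_k|r^k=|a_k|s^k\cdot(r/s)^k$.
  have hcs := Finset.sum_mul_sq_le_sq_mul_sq (Finset.range n)
    (fun k => ‖a (k + 1)‖ * s ^ (k + 1)) (fun k => (r / s) ^ (k + 1))
  have e1 : ∀ k, ‖a (k + 1)‖ * s ^ (k + 1) * (r / s) ^ (k + 1) = ‖a (k + 1)‖ * r ^ (k + 1) :=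
    fun k => by rw [mul_assoc, ← mul_pow, mul_div_cancel₀ _ hs0.ne']
  have e2 : ∀ k, (‖a (k + 1)‖ * s ^ (k + 1)) ^ 2 = ‖a (k + 1)‖ ^ 2 * (s ^ 2) ^ (k + 1) :=
    fun k => by rw [mul_pow, ← pow_mul, ← pow_mul, mul_comm 2]
  have e3 : ∀ k : ℕ, ((r / s) ^ (k + 1)) ^ 2 = q ^ (k + 1) :=
    fun k => by rw [← pow_mul, mul_comm _ 2, pow_mul, div_pow, hss]
  simp only [e1, e2, e3] at hcs
  set A := ∑ k ∈ Finset.range n, ‖a (k + 1)‖ ^ 2 * (s ^ 2) ^ (k + 1) with hA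
  have hA0 : 0 ≤ A := Finset.sum_nonneg fun k _ => by positivity
  have hpos : 0 ≤ 1 - ‖a 0‖ ^ 2 * ρ := by nlinarith [norm_nonneg (a 0)]
  have hA1 : (1 - ‖a 0‖ ^ 2 * ρ) * A ≤ ρ * (1 - ‖a 0‖ ^ 2) ^ 2 := by
    rw [← hss] at hpos ⊢
    exact (mul_le_mul_of_nonneg_left hfin hpos).trans hS
  have hq2 : (ρ - r ^ 2) * (q / (1 - q)) = r ^ 2 := by
    have : ρ - r ^ 2 ≠ 0 := (sub_pos.2 hρ).ne'
    rw [hq]; field_simp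
  calc _ ≤ (A * (q / (1 - q))) * ((1 - ‖a 0‖ ^ 2 * ρ) * (ρ - r ^ 2)) := by
        refine mul_le_mul_of_nonneg_right (hcs.trans ?_) (mul_nonneg hpos (sub_pos.2 hρ).le)
        exact mul_le_mul_of_nonneg_left hgeo hA0
    _ = ((1 - ‖a 0‖ ^ 2 * ρ) * A) * ((ρ - r ^ 2) * (q / (1 - q))) := by ring
    _ ≤ _ := by rw [hq2]; exact mul_le_mul_of_nonneg_right hA1 (sq_nonneg r)

/-- The endpoint $\rho=1$ is a limit from below; the finite sum does not depend on $\rho$. -/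
lemma sq_sum_mul_le {h : ℂ → ℂ} (hh : h ∈ classB) {a : ℕ → ℂ}
    (ha : ∀ z ∈ unitDisk, HasSum (fun k => a k * z ^ k) (h z)) {r ρ : ℝ}
    (hρ : r ^ 2 < ρ) (hρ1 : ρ ≤ 1) (n : ℕ) :
    (∑ k ∈ Finset.range n, ‖a (k + 1)‖ * r ^ (k + 1)) ^ 2 *
      ((1 - ‖a 0‖ ^ 2 * ρ) * (ρ - r ^ 2)) ≤ ρ * (1 - ‖a 0‖ ^ 2) ^ 2 * r ^ 2 := by
  rcases hρ1.lt_or_eq with h1 | rfl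
  · exact sq_sum_mul_le_of_lt_one hh ha hρ h1 n
  · set T := ∑ k ∈ Finset.range n, ‖a (k + 1)‖ * r ^ (k + 1)
    have hL : Tendsto (fun ρ : ℝ => T ^ 2 * ((1 - ‖a 0‖ ^ 2 * ρ) * (ρ - r ^ 2))) (𝓝[<] 1)
        (𝓝 (T ^ 2 * ((1 - ‖a 0‖ ^ 2 * 1) * (1 - r ^ 2)))) :=
      (Continuous.tendsto (by fun_prop) 1).mono_left nhdsWithin_le_nhds
    have hR : Tendsto (fun ρ : ℝ => ρ * (1 - ‖a 0‖ ^ 2) ^ 2 * r ^ 2) (𝓝[<] 1)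
        (𝓝 (1 * (1 - ‖a 0‖ ^ 2) ^ 2 * r ^ 2)) :=
      (Continuous.tendsto (by fun_prop) 1).mono_left nhdsWithin_le_nhds
    refine le_of_tendsto_of_tendsto hL hR ?_
    filter_upwards [Ioo_mem_nhdsLT hρ] with ρ hρ
    exact sq_sum_mul_le_of_lt_one hh ha hρ.1 hρ.2 n

/-- The optimal weight depends on whether $r\le x$, not on whether $x<1/2$. For $r\le x<1/2$ the
bound $r(1+2x)\le1$ is automatic, and $x\ge1/2$ forces $r\le1/2\le x$. -/
lemma le_bohrR1_cases {x r : ℝ} (hr : r ≤ bohrR1 x) (hr0 : 0 ≤ r) :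
    (r ≤ x ∧ r * (1 + 2 * x) ≤ 1) ∨ (x < r ∧ 2 * r ^ 2 ≤ 1 - x) := by
  unfold bohrR1 at hr
  split_ifs at hr with hx
  · rw [Real.le_sqrt hr0 (by linarith)] at hr
    rcases le_or_gt r x with h | h
    · exact Or.inl ⟨h, by nlinarith⟩
    · exact Or.inr ⟨h, by linarith⟩
  · rw [le_div_iff₀ (by linarith)] at hr
    exact Or.inl ⟨by nlinarith, hr⟩

lemma lt_one_of_le_bohrR1 {x r : ℝ} (hx0 : 0 ≤ x) (hr0 : 0 ≤ r)
    (hr : r ≤ bohrR1 x) : r < 1 := by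
  rcases le_bohrR1_cases hr hr0 with h | h <;> nlinarith

lemma one_third_le_bohrR1 {x : ℝ} (hx0 : 0 ≤ x) (hx1 : x ≤ 1) : 1 / 3 ≤ bohrR1 x := by
  unfold bohrR1
  split_ifs with hx
  · exact Real.le_sqrt_of_sq_le (by linarith)
  · exact one_div_le_one_div_of_le (by linarith) (by linarith)

/-- The refined **Bohr inequality**: the majorant series of a function `h ∈ 𝓑` is at most `1` up to
the radius `bohrR1 ‖h 0‖`. -/
lemma tsum_norm_mul_pow_le_one {h : ℂ → ℂ} (hh : h ∈ classB) {a : ℕ → ℂ}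
    (ha : ∀ z ∈ unitDisk, HasSum (fun k => a k * z ^ k) (h z)) {r : ℝ} (hr : 0 ≤ r)
    (hr1 : r ≤ bohrR1 ‖h 0‖) :
    Summable (fun k => ‖a k‖ * r ^ k) ∧ ∑' k, ‖a k‖ * r ^ k ≤ 1 := by
  have hx1 : ‖h 0‖ ≤ 1 := hh.2 0 (by simp [unitDisk])
  have hlt := lt_one_of_le_bohrR1 (norm_nonneg _) hr hr1
  have hcases := le_bohrR1_cases hr1 hr
  rw [apply_zero_of_hasSum ha] at hx1 hcases
  have hs := summable_norm_mul_pow_of_hasSum ha hr hlt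
  refine ⟨hs, ?_⟩
  have hx0 := norm_nonneg (a 0)
  rw [hs.tsum_eq_zero_add, pow_zero, mul_one, ← le_sub_iff_add_le']
  refine ((summable_nat_add_iff 1).2 hs).tsum_le_of_sum_range_le fun n => ?_
  rcases hr.eq_or_lt with rfl | hrpos
  · simpa using hx1
  have hT0 : 0 ≤ ∑ k ∈ Finset.range n, ‖a (k + 1)‖ * r ^ (k + 1) :=
    Finset.sum_nonneg fun k _ => by positivity
  have key := fun ρ h1 h2 => sq_sum_mul_le (r := r) (ρ := ρ) hh ha h1 h2 n
  generalize (∑ k ∈ Finset.range n, ‖a (k + 1)‖ * r ^ (k + 1)) = T at hT0 key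
  generalize ‖a 0‖ = x at *
  rcases hcases with ⟨h1, h2⟩ | ⟨h1, h2⟩
  -- $\rho=r/x$ maximizes $(1-x^2\rho)(\rho-r^2)/\rho$, with value $(1-xr)^2$; it is admissible
  -- because $r\le x$.
  · have hxp : 0 < x := hrpos.trans_le h1
    have hk := key (r / x) (by rw [lt_div_iff₀ hxp]; nlinarith) ((div_le_one hxp).2 h1)
    have e1 : (1 - x ^ 2 * (r / x)) * (r / x - r ^ 2) = (r / x) * (1 - x * r) ^ 2 := by
      field_simp
    have hxr : 0 < 1 - x * r := by nlinarith
    have hrx : 0 < r / x := by positivity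
    rw [e1] at hk
    have hk2 : (T * (1 - x * r)) ^ 2 ≤ ((1 - x ^ 2) * r) ^ 2 :=
      le_of_mul_le_mul_left (by nlinarith) hrx
    have hx2 : 0 ≤ 1 - x ^ 2 := by nlinarith
    have hk3 := abs_le_of_sq_le_sq' hk2 (by positivity) |>.2
    refine le_of_mul_le_mul_right (hk3.trans ?_) hxr
    nlinarith [mul_nonneg (sub_nonneg.2 hx1) (sub_nonneg.2 h2)]
  -- Here $r/x$ would exceed $1$ (or $x=0$), so the endpoint $\rho=1$ is best.
  · have hk := key 1 (by nlinarith) le_rfl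
    have hxlt : x < 1 := by nlinarith
    have hx2 : 0 < 1 - x ^ 2 := by nlinarith
    have hr2 : 0 < 1 - r ^ 2 := by nlinarith
    have hk2 : T ^ 2 * (1 - r ^ 2) ≤ (1 - x ^ 2) * r ^ 2 :=
      le_of_mul_le_mul_left (by nlinarith) hx2
    refine (abs_le_of_sq_le_sq' ?_ (sub_nonneg.2 hx1)).2
    refine le_of_mul_le_mul_right (hk2.trans ?_) hr2
    nlinarith [mul_nonneg (sub_nonneg.2 hx1) (sub_nonneg.2 h2)]

/-! ### Majorant sums of products and powers -/

namespace PowerSeries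

/-- The majorant series `∑ |cₖ| r ^ k` of `P = ∑ cₖ X ^ k` converges to a sum at most `m`. -/
def MajorantLE (P : PowerSeries ℂ) (r m : ℝ) : Prop :=
  Summable (fun k => ‖coeff k P‖ * r ^ k) ∧ ∑' k, ‖coeff k P‖ * r ^ k ≤ m

lemma norm_coeff_mul_mul_pow_le (P Q : PowerSeries ℂ) {r : ℝ} (hr : 0 ≤ r) (k : ℕ) :
    ‖coeff k (P * Q)‖ * r ^ k ≤ ∑ ij ∈ Finset.HasAntidiagonal.antidiagonal k,
      (‖coeff ij.1 P‖ * r ^ ij.1) * (‖coeff ij.2 Q‖ * r ^ ij.2) := by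
  rw [coeff_mul]
  refine (mul_le_mul_of_nonneg_right (norm_sum_le _ _) (by positivity)).trans_eq ?_
  rw [Finset.sum_mul]
  refine Finset.sum_congr rfl fun ij hij => ?_
  rw [norm_mul, ← Finset.HasAntidiagonal.mem_antidiagonal.1 hij, pow_add]
  ring

lemma MajorantLE.mul {P Q : PowerSeries ℂ} {r m m' : ℝ} (hr : 0 ≤ r) (hP : P.MajorantLE r m)
    (hQ : Q.MajorantLE r m') : (P * Q).MajorantLE r (m * m') := by
  have nP : ∀ k, 0 ≤ ‖coeff k P‖ * r ^ k := fun k => mul_nonneg (norm_nonneg _) (pow_nonneg hr k)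
  have nQ : ∀ k, 0 ≤ ‖coeff k Q‖ * r ^ k := fun k => mul_nonneg (norm_nonneg _) (pow_nonneg hr k)
  have hPQ : Summable fun x : ℕ × ℕ =>
      (‖coeff x.1 P‖ * r ^ x.1) * (‖coeff x.2 Q‖ * r ^ x.2) :=
    Summable.mul_of_nonneg (f := fun k => ‖coeff k P‖ * r ^ k)
      (g := fun k => ‖coeff k Q‖ * r ^ k) hP.1 hQ.1 nP nQ
  have hs := summable_sum_mul_antidiagonal_of_summable_mul
    (f := fun k => ‖coeff k P‖ * r ^ k) (g := fun k => ‖coeff k Q‖ * r ^ k) hPQ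
  have hle := norm_coeff_mul_mul_pow_le P Q hr
  have hs' : Summable fun k => ‖coeff k (P * Q)‖ * r ^ k :=
    hs.of_nonneg_of_le (fun k => mul_nonneg (norm_nonneg _) (pow_nonneg hr k)) hle
  refine ⟨hs', (hs'.tsum_le_tsum hle hs).trans ?_⟩
  rw [← hP.1.tsum_mul_tsum_eq_tsum_sum_antidiagonal hQ.1 hPQ]
  exact mul_le_mul hP.2 hQ.2 (tsum_nonneg nQ) ((tsum_nonneg nP).trans hP.2)

lemma MajorantLE.one (r : ℝ) : (1 : PowerSeries ℂ).MajorantLE r 1 := by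
  have h : HasSum (fun k => ‖coeff k (1 : PowerSeries ℂ)‖ * r ^ k) 1 := by
    convert hasSum_ite_eq (0 : ℕ) (1 : ℝ) using 2 with k
    rcases k with _ | k <;> simp [coeff_one]
  exact ⟨h.summable, h.tsum_eq.le⟩

lemma MajorantLE.pow {P : PowerSeries ℂ} {r m : ℝ} (hr : 0 ≤ r) (hP : P.MajorantLE r m) (n : ℕ) :
    (P ^ n).MajorantLE r (m ^ n) := by
  induction n with
  | zero => simpa using MajorantLE.one r
  | succ n ih => simpa only [pow_succ] using ih.mul hr hP

lemma MajorantLE.summable_norm {P : PowerSeries ℂ} {r m : ℝ} (hP : P.MajorantLE r m) {z : ℂ}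
    (hz : ‖z‖ ≤ r) : Summable fun k => ‖coeff k P * z ^ k‖ :=
  hP.1.of_nonneg_of_le (fun k => norm_nonneg _) fun k => by
    rw [norm_mul, norm_pow]; gcongr

lemma MajorantLE.hasSum_mul {P Q : PowerSeries ℂ} {r m m' : ℝ} (hP : P.MajorantLE r m)
    (hQ : Q.MajorantLE r m') {z p q : ℂ} (hz : ‖z‖ ≤ r)
    (hp : HasSum (fun k => coeff k P * z ^ k) p) (hq : HasSum (fun k => coeff k Q * z ^ k) q) :
    HasSum (fun k => coeff k (P * Q) * z ^ k) (p * q) := by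
  have h1 := hP.summable_norm hz
  have h2 := hQ.summable_norm hz
  have h3 := tsum_mul_tsum_eq_tsum_sum_antidiagonal_of_summable_norm h1 h2
  have h4 := (((hP.mul ((norm_nonneg z).trans hz) hQ).summable_norm hz).of_norm).hasSum
  rw [hp.tsum_eq, hq.tsum_eq] at h3
  rw [h3]
  suffices e : ∀ k, coeff k (P * Q) * z ^ k = ∑ ij ∈ Finset.HasAntidiagonal.antidiagonal k,
      coeff ij.1 P * z ^ ij.1 * (coeff ij.2 Q * z ^ ij.2) by
    simpa only [e] using h4
  intro k
  rw [coeff_mul, Finset.sum_mul]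
  refine Finset.sum_congr rfl fun ij hij => ?_
  rw [← Finset.HasAntidiagonal.mem_antidiagonal.1 hij, pow_add]
  ring

lemma MajorantLE.hasSum_pow {P : PowerSeries ℂ} {r m : ℝ} (hP : P.MajorantLE r m) {z p : ℂ}
    (hz : ‖z‖ ≤ r) (hp : HasSum (fun k => coeff k P * z ^ k) p) (n : ℕ) :
    HasSum (fun k => coeff k (P ^ n) * z ^ k) (p ^ n) := by
  have hr := (norm_nonneg z).trans hz
  induction n with
  | zero =>
    convert hasSum_ite_eq (0 : ℕ) (1 : ℂ) using 2 with k
    · rcases k with _ | k <;> simp [coeff_one]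
    · simp
  | succ n ih => simpa only [pow_succ] using (hP.pow hr n).hasSum_mul hP hz ih hp

end PowerSeries

/-! ### Taylor series of bounded and Schwarz functions -/

lemma exists_hasSum_of_mem_classB {h : ℂ → ℂ} (hh : h ∈ classB) :
    ∃ P : PowerSeries ℂ, ∀ z ∈ unitDisk, HasSum (fun k => PowerSeries.coeff k P * z ^ k) (h z) := by
  refine ⟨PowerSeries.mk fun n => (n.factorial : ℂ)⁻¹ * iteratedDeriv n h 0, fun z hz => ?_⟩
  have := Complex.hasSum_taylorSeries_on_ball (c := 0) (r := 1) (f := h) (z := z)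
    hh.1.differentiableOn hz
  refine this.congr_fun fun k => ?_
  simp only [PowerSeries.coeff_mk, sub_zero, smul_eq_mul]
  ring

lemma dslope_mem_classB {w : ℂ → ℂ} (hw : w ∈ classB) (hw0 : w 0 = 0) : dslope w 0 ∈ classB := by
  have hd : DifferentiableOn ℂ w unitDisk := hw.1.differentiableOn
  refine ⟨DifferentiableOn.analyticOnNhd ?_ Metric.isOpen_ball, fun z hz => ?_⟩
  · exact (Complex.differentiableOn_dslope (Metric.isOpen_ball.mem_nhds (by simp))).2 hd
  · simpa using Complex.norm_dslope_le_div_of_mapsTo_ball (R₁ := 1) (R₂ := 1) hd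
      (fun z hz => by simpa [hw0] using hw.2 z hz) hz

/-- A power series with constant term `0` and majorant sum at most `r` for a Schwarz function. -/
lemma exists_majorantLE_of_schwarz {w : ℂ → ℂ} (hw : w ∈ classB) (hw0 : w 0 = 0) {r : ℝ}
    (hr : 0 ≤ r) (hr1 : r ≤ bohrR1 ‖deriv w 0‖) :
    ∃ W : PowerSeries ℂ, W.MajorantLE r r ∧
      ∀ z ∈ unitDisk, HasSum (fun k => PowerSeries.coeff k W * z ^ k) (w z) := by
  have hψ := dslope_mem_classB hw hw0
  obtain ⟨P, hP⟩ := exists_hasSum_of_mem_classB hψ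
  have hB := tsum_norm_mul_pow_le_one hψ hP hr (by rwa [dslope_same])
  have hX : ∀ k, ‖PowerSeries.coeff (k + 1) (PowerSeries.X * P)‖ * r ^ (k + 1)
      = r * (‖PowerSeries.coeff k P‖ * r ^ k) := fun k => by
    rw [PowerSeries.coeff_succ_X_mul, pow_succ]; ring
  refine ⟨PowerSeries.X * P, ?_, fun z hz => ?_⟩
  · have hs : Summable fun k => ‖PowerSeries.coeff k (PowerSeries.X * P)‖ * r ^ k :=
      (summable_nat_add_iff 1).1 (by simpa only [hX] using hB.1.mul_left r)
    refine ⟨hs, ?_⟩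
    rw [hs.tsum_eq_zero_add]
    simp only [hX, tsum_mul_left]
    simpa using mul_le_mul_of_nonneg_left hB.2 hr
  · refine (hasSum_nat_add_iff' 1).1 ?_
    have e : w z = z * dslope w 0 z := by
      have := sub_smul_dslope w 0 z
      simpa [hw0] using this.symm
    have e0 : w z - ∑ i ∈ Finset.range 1, PowerSeries.coeff i (PowerSeries.X * P) * z ^ i
        = z * dslope w 0 z := by simp [e]
    rw [e0]
    refine ((hP z hz).mul_left z).congr_fun fun k => ?_
    rw [PowerSeries.coeff_succ_X_mul, pow_succ]; ring

/-- Uniqueness of the coefficients of a convergent power series. -/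
lemma coeff_unique {f : ℂ → ℂ} {a c : ℕ → ℂ}
    (ha : ∀ᶠ z in 𝓝 0, HasSum (fun k => a k * z ^ k) (f z))
    (hc : ∀ᶠ z in 𝓝 0, HasSum (fun k => c k * z ^ k) (f z)) : a = c := by
  have key : ∀ d : ℕ → ℂ, (∀ᶠ z in 𝓝 0, HasSum (fun k => d k * z ^ k) (f z)) →
      HasFPowerSeriesAt f (FormalMultilinearSeries.ofScalars ℂ d) 0 := fun d hd => by
    rw [hasFPowerSeriesAt_iff]
    simpa [FormalMultilinearSeries.coeff_ofScalars, mul_comm] using hd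
  have h := (key a ha).eq_formalMultilinearSeries (key c hc)
  ext k
  simpa using congrArg (fun p => p.coeff k) h

/-! ### Superpositions of power series -/

section Superposition

variable {b : ℕ → ℂ} {q : ℕ → ℕ → ℂ} {r : ℝ}

/-- This absolute convergence justifies both exchanges of summation below. -/
lemma summable_norm_superposition (hr : 0 ≤ r) (hb : Summable fun n => ‖b n‖ * r ^ n)
    (hq : ∀ n, Summable (fun k => ‖q n k‖ * r ^ k) ∧ ∑' k, ‖q n k‖ * r ^ k ≤ r ^ n) :
    Summable fun p : ℕ × ℕ => ‖b p.1‖ * (‖q p.1 p.2‖ * r ^ p.2) := by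
  have hpos : ∀ p : ℕ × ℕ, 0 ≤ ‖b p.1‖ * (‖q p.1 p.2‖ * r ^ p.2) := fun p => by positivity
  refine (summable_prod_of_nonneg hpos).2 ⟨fun n =>
    Summable.mul_left (f := fun k => ‖q n k‖ * r ^ k) ‖b n‖ (hq n).1, ?_⟩
  refine Summable.of_nonneg_of_le (fun n => tsum_nonneg fun k => hpos (n, k)) (fun n => ?_) hb
  simp only [tsum_mul_left]
  exact mul_le_mul_of_nonneg_left (hq n).2 (norm_nonneg _)

/-- The majorant series of `∑ bₙ qₙ` is at most that of `∑ bₙ Xⁿ` if the majorant sum of each `qₙ`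
at `r` is at most `r ^ n`. -/
lemma tsum_norm_superposition_le (hr : 0 < r) (hb : Summable fun n => ‖b n‖ * r ^ n)
    (hq : ∀ n, Summable (fun k => ‖q n k‖ * r ^ k) ∧ ∑' k, ‖q n k‖ * r ^ k ≤ r ^ n)
    (ha : Summable fun k => ‖∑' n, b n * q n k‖ * r ^ k) :
    ∑' k, ‖∑' n, b n * q n k‖ * r ^ k ≤ ∑' n, ‖b n‖ * r ^ n := by
  have hS := summable_norm_superposition hr.le hb hq
  calc _ ≤ ∑' k, ∑' n, ‖b n‖ * (‖q n k‖ * r ^ k) := by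
        refine ha.tsum_le_tsum (fun k => ?_) hS.prod_symm.prod
        have hk : Summable fun n => ‖b n‖ * (‖q n k‖ * r ^ k) := hS.prod_symm.prod_factor k
        have hk' : Summable fun n => ‖b n * q n k‖ := by
          refine (summable_mul_right_iff (pow_pos hr k).ne').1 ?_
          simpa [mul_assoc] using hk
        refine (mul_le_mul_of_nonneg_right (norm_tsum_le_tsum_norm hk') (by positivity)).trans_eq ?_
        rw [← tsum_mul_right]
        simp [mul_assoc]
    _ = ∑' n, ∑' k, ‖b n‖ * (‖q n k‖ * r ^ k) :=
        Summable.tsum_comm (f := fun n k => ‖b n‖ * (‖q n k‖ * r ^ k)) hS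
    _ ≤ _ := by
        refine hS.prod.tsum_le_tsum (fun n => ?_) hb
        simp only [tsum_mul_left]
        exact mul_le_mul_of_nonneg_left (hq n).2 (norm_nonneg _)

lemma hasSum_superposition (hr : 0 ≤ r) (hb : Summable fun n => ‖b n‖ * r ^ n)
    (hq : ∀ n, Summable (fun k => ‖q n k‖ * r ^ k) ∧ ∑' k, ‖q n k‖ * r ^ k ≤ r ^ n)
    {z S : ℂ} {v : ℕ → ℂ} (hz : ‖z‖ ≤ r) (hv : ∀ n, HasSum (fun k => q n k * z ^ k) (v n))
    (hS : HasSum (fun n => b n * v n) S) :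
    HasSum (fun k => (∑' n, b n * q n k) * z ^ k) S := by
  have hu : Summable fun p : ℕ × ℕ => b p.1 * (q p.1 p.2 * z ^ p.2) := by
    refine Summable.of_norm_bounded (summable_norm_superposition hr hb hq) fun p => ?_
    rw [norm_mul, norm_mul, norm_pow]
    gcongr
  have htot := (hu.hasSum.prod_fiberwise fun n => (hv n).mul_left (b n)).unique hS
  have hswap := (Equiv.prodComm ℕ ℕ).hasSum_iff.2 hu.hasSum
  rw [htot] at hswap
  have := hswap.prod_fiberwise fun k => (hswap.summable.prod_factor k).hasSum
  simpa [← mul_assoc, tsum_mul_right] using this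

end Superposition

/-! ### Quasi-subordination -/

theorem theorem2 (f g : ℂ → ℂ) (a b : ℕ → ℂ)
    (hf : AnalyticOnNhd ℂ f unitDisk) (hg : AnalyticOnNhd ℂ g unitDisk)
    (hfa : ∀ z ∈ unitDisk, HasSum (fun k : ℕ => a k * z ^ k) (f z))
    (hgb : ∀ z ∈ unitDisk, HasSum (fun k : ℕ => b k * z ^ k) (g z))
    (Φ ω : ℂ → ℂ) (hΦ : Φ ∈ classB) (hω : ω ∈ classB) (hω0 : ω 0 = 0)
    (hfg : ∀ z ∈ unitDisk, f z = Φ z * g (ω z)) :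
    (∀ r : ℝ, 0 ≤ r → r ≤ min (bohrR1 ‖Φ 0‖) (bohrR1 ‖deriv ω 0‖) →
      Summable (fun k : ℕ => ‖a k‖ * r ^ k) ∧
      Summable (fun k : ℕ => ‖b k‖ * r ^ k) ∧
      ∑' k : ℕ, ‖a k‖ * r ^ k ≤ ∑' k : ℕ, ‖b k‖ * r ^ k) ∧
    1 / 3 ≤ min (bohrR1 ‖Φ 0‖) (bohrR1 ‖deriv ω 0‖) := by
  have hzero : (0 : ℂ) ∈ unitDisk := by simp [unitDisk]
  have hx1 : ‖Φ 0‖ ≤ 1 := hΦ.2 0 hzero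
  have hy1 : ‖deriv ω 0‖ ≤ 1 := by
    simpa using (dslope_mem_classB hω hω0).2 0 hzero
  refine ⟨fun r hr hrle => ?_, le_min (one_third_le_bohrR1 (norm_nonneg _) hx1)
    (one_third_le_bohrR1 (norm_nonneg _) hy1)⟩
  obtain ⟨hr1, hr2⟩ := le_min_iff.1 hrle
  have hlt := lt_one_of_le_bohrR1 (norm_nonneg _) hr hr1
  have hsa := summable_norm_mul_pow_of_hasSum hfa hr hlt
  have hsb := summable_norm_mul_pow_of_hasSum hgb hr hlt
  refine ⟨hsa, hsb, ?_⟩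
  obtain ⟨P, hP⟩ := exists_hasSum_of_mem_classB hΦ
  have hPm : P.MajorantLE r 1 := tsum_norm_mul_pow_le_one hΦ hP hr hr1
  obtain ⟨W, hWm, hW⟩ := exists_majorantLE_of_schwarz hω hω0 hr hr2
  have hQ : ∀ n, (P * W ^ n).MajorantLE r (r ^ n) := fun n => by
    simpa using hPm.mul hr (hWm.pow hr n)
  -- At $r=0$ only $|a_0|\le|b_0|$ remains; identifying coefficients below needs a disk of positive
  -- radius.
  rcases hr.eq_or_lt with rfl | hrpos
  · rw [tsum_eq_single 0 (by simp +contextual), tsum_eq_single 0 (by simp +contextual)]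
    have h1 := hfg 0 hzero
    rw [hω0, apply_zero_of_hasSum hfa, apply_zero_of_hasSum hgb] at h1
    simpa [h1] using mul_le_mul_of_nonneg_right hx1 (norm_nonneg (b 0))
  obtain ⟨q, hq⟩ : ∃ q : ℕ → ℕ → ℂ, ∀ n k, q n k = PowerSeries.coeff k (P * W ^ n) :=
    ⟨_, fun _ _ => rfl⟩
  have hqm : ∀ n, Summable (fun k => ‖q n k‖ * r ^ k) ∧ ∑' k, ‖q n k‖ * r ^ k ≤ r ^ n :=
    fun n => by simp only [hq]; exact hQ n
  have hA : a = fun k => ∑' n, b n * q n k := by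
    refine coeff_unique (f := f) ?_ ?_
    · filter_upwards [Metric.ball_mem_nhds (0 : ℂ) one_pos] with z hz using hfa z hz
    · filter_upwards [Metric.ball_mem_nhds (0 : ℂ) hrpos] with z hz
      rw [mem_ball_zero_iff] at hz
      have hz1 := hz.trans hlt
      have hzD : z ∈ unitDisk := mem_unitDisk.2 hz1
      have hωD : ω z ∈ unitDisk := mem_unitDisk.2 <|
        (Complex.norm_le_norm_of_mapsTo_ball (R := 1) hω.1.differentiableOn
          (fun z hz => mem_closedBall_zero_iff.2 (hω.2 z hz)) hω0 hz1).trans_lt hz1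
      refine hasSum_superposition hr hsb hqm hz.le (v := fun n => Φ z * ω z ^ n) (fun n => ?_) ?_
      · simpa only [hq] using hPm.hasSum_mul (hWm.pow hr n) hz.le (hP z hzD)
          (hWm.hasSum_pow hz.le (hW z hzD) n)
      · rw [hfg z hzD]
        exact ((hgb _ hωD).mul_left (Φ z)).congr_fun fun n => mul_left_comm _ _ _
  rw [hA] at hsa ⊢
  exact tsum_norm_superposition_le hrpos hsb hqm hsa
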